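/- Conventions. Categories have object and hom sets in fixed universes, $\mathrm{Set}$ is the category of sets of the hom universe, and $m,n\ge 0$. **The double Chu construction $\mathbb{C}\mathrm{hu}(\mathrm{Cat},\mathrm{Set})$.** An *object* is a triple $(A^+,A^-,\underline A)$ of two categories and a functor $\underline A:A^+\times A^-\to\mathrm{Set}$. A *vertical arrow* $u:A\to C$ is a triple of functors $u^\pm:A^\pm\to C^\pm$ and a natural transformation $\underline u:\underline A\Rightarrow\underline C\circ(u^+\times u^-)$. A *horizontal polyarrow* $f:(A_1,\dots,A_m)\to(B_1,\dots,B_n)$ consists of functors $$f_j^+:\prod_i A_i^+\times\prod_{j'\ne j}B_{j'}^-\to B_j^+,\qquad f_i^-:\prod_{i'\neq i}A_{i'}^+\times\prod_j B_j^-\to A_i^-,$$ for $1\le j\le n$ and $1\le i\le m$, with a clique (a family of isomorphisms $\theta_{kl}$ between any two members, satisfying $\theta_{kk}=1$ and $\theta_{lp}\theta_{kl}=\theta_{kp}$) on the $m+n$ functors $\underline A_i\circ(1,f_i^-)$, $\underline B_j\circ(1,f_j^+):\prod_i A_i^+\times\prod_j B_j^-\to\mathrm{Set}$. Given polyarrows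 $f:(A_1,\dots,A_m)\to(B_1,\dots,B_n)$ and $g:(C_1,\dots,C_m)\to(D_1,\dots,D_n)$ and vertical arrows $u_i:A_i\to C_i$, $v_j:B_j\to D_j$, a *2-cell* $\mu$ with this boundary is a family of natural transformations $$\mu_j^+:v_j^+\circ f_j^+\Rightarrow g_j^+\circ(u_1^+,\dots,u_m^+,v_1^-,\dots,\widehat{v_j^-},\dots,v_n^-),\qquad \mu_i^-:u_i^-\circ f_i^-\Rightarrow g_i^-\circ(u_1^+,\dots,\widehat{u_i^+},\dots,u_m^+,v_1^-,\dots,v_n^-)$$ such that any two of the induced transformations $\underline u_i\circ(1,\mu_i^-)$, $\underline v_j\circ(1,\mu_j^+)$ commute with the clique isomorphisms of $f$ and $g$. **$\mathbb{M}\mathrm{Adj}$.** The poly double category $\mathbb{M}\mathrm{Adj}$ of multivariable adjunctions has as objects the triples $(\mathcal A,\mathcal A^{\mathrm{op}},\hom_{\mathcal A})$, where $\hom_{\mathcal A}(a,a')=\mathcal A(a',a)$, as vertical arrows the triples $(F,F^{\mathrm{op}},\hom_F)$ for functors $F$, and all horizontal polyarrows and 2-cells of $\mathbb{C}\mathrm{hu}(\mathrm{Cat},\mathrm{Set})$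 between these. **Statement.** 1. Fix a boundary $(u,v,f,g)$ in $\mathbb{M}\mathrm{Adj}$, and fix any one of the $m+n$ component positions ($j,+$) or ($i,-$). Then every natural transformation of the type required at this position is the component of exactly one 2-cell of $\mathbb{M}\mathrm{Adj}$ with this boundary. In particular, a 2-cell is uniquely determined by any single one of its components $\mu_j^+$ or $\mu_i^-$. 2. The other components are forced as the multivariable mates of the given one: for a 2-cell $\mu$ and two positions $k,l$, a transformation $\sigma$ of the type required at $l$ is the mate of the component $\mu_k$ if and only if $\sigma=\mu_l$. Here $\sigma$ is the mate of $\mu_k$ if each of its values is obtained from the identity of the corresponding value of the $l$-th component functor of $f$ by transposing it to position $k$ along the adjunction isomorphism of $f$, applying the vertical arrow and $\mu_k$ at position $k$, and transposing the result back to position $l$ along the adjunction isomorphism of $g$. 3. This fails in $\mathbb{C}\mathrm{hu}(\mathrm{Cat},\mathrm{Set})$: there is a boundary with $m=n=1$ such that neither of the two components $\mu^+$, $\mu^-$ determines the 2-cell, i.e. for each of them there are two different 2-cells with this boundary that share it. -/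

import Mathlib

open CategoryTheory Opposite

universe v u

namespace MultiAdj

/-- A clique on a family of objects: a functor from the chaotic category on the index set, that is,
a family of isomorphisms `θ k l : φ k ≅ φ l` with `θ k k = 1` and `θ l p ∘ θ k l = θ k p`. -/
structure Clique {X : Type*} [Category* X] {K : Type*} (φ : K → X) where
  iso (k l : K) : φ k ≅ φ l
  iso_self (k : K) : iso k k = Iso.refl (φ k)
  iso_trans (k l p : K) : iso k l ≪≫ iso l p = iso k p

/-! ### The double Chu construction `Chu(Cat, Set)` -/

/-- Objects of `Chu(Cat, Set)`: triples `(A⁺, A⁻, A̲)` with `A̲ : A⁺ × A⁻ ⥤ Set`. -/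
structure ChuObj where
  pos : Cat.{v, u}
  neg : Cat.{v, u}
  pair : pos × neg ⥤ Type v

/-- Vertical arrows of `Chu(Cat, Set)`: triples `(u⁺, u⁻, u̲)` with
`u̲ : A̲ ⟶ B̲ ∘ (u⁺ × u⁻)`. Both functors go forwards. -/
structure VertArrow (A B : ChuObj.{v, u}) where
  pos : A.pos ⥤ B.pos
  neg : A.neg ⥤ B.neg
  pair : A.pair ⟶ pos.prod neg ⋙ B.pair

section Poly

variable {m n : ℕ}

/-- The variables of a polyarrow `(A₁, …, Aₘ) → (B₁, …, Bₙ)`: the index `inl i` stands for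
`Aᵢ⁺` and the index `inr j` stands for `Bⱼ⁻`. -/
abbrev Var (A : Fin m → ChuObj.{v, u}) (B : Fin n → ChuObj.{v, u}) : Fin m ⊕ Fin n → Cat.{v, u}
  | .inl i => (A i).pos
  | .inr j => (B j).neg

/-- The codomains of the components of a polyarrow `(A₁, …, Aₘ) → (B₁, …, Bₙ)`: the component
`inl i` is `fᵢ⁻`, with values in `Aᵢ⁻`, and the component `inr j` is `fⱼ⁺`, with values in
`Bⱼ⁺`. -/
abbrev Val (A : Fin m → ChuObj.{v, u}) (B : Fin n → ChuObj.{v, u}) : Fin m ⊕ Fin n → Cat.{v, u}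
  | .inl i => (A i).neg
  | .inr j => (B j).pos

/-- The pairing of the `k`-th variable with the values of the `k`-th component, which is `A̲ᵢ` or
`B̲ⱼ`. -/
def pairing (A : Fin m → ChuObj.{v, u}) (B : Fin n → ChuObj.{v, u}) :
    (k : Fin m ⊕ Fin n) → Var A B k × Val A B k ⥤ Type v
  | .inl i => (A i).pair
  | .inr j => CategoryTheory.Prod.swap (B j).neg (B j).pos ⋙ (B j).pair

/-- The product `A₁⁺ × ⋯ × Aₘ⁺ × B₁⁻ × ⋯ × Bₙ⁻` of all variables. -/
abbrev Vars (A : Fin m → ChuObj.{v, u}) (B : Fin n → ChuObj.{v, u}) : Type u :=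
  ∀ k : Fin m ⊕ Fin n, Var A B k

/-- The product of all variables but the `k`-th one. -/
abbrev Others (A : Fin m → ChuObj.{v, u}) (B : Fin n → ChuObj.{v, u}) (k : Fin m ⊕ Fin n) :
    Type u :=
  ∀ l : {l : Fin m ⊕ Fin n // l ≠ k}, Var A B l.1

/-- The projection that omits the `k`-th variable. -/
def omitVar (A : Fin m → ChuObj.{v, u}) (B : Fin n → ChuObj.{v, u}) (k : Fin m ⊕ Fin n) :
    Vars A B ⥤ Others A B k :=
  Pi.comap (fun l => Var A B l) Subtype.val

/-- The functors `A̲ᵢ ∘ (1, fᵢ⁻)` and `B̲ⱼ ∘ (1, fⱼ⁺)` from the product of all variables to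
`Set`. -/
def hetero {A : Fin m → ChuObj.{v, u}} {B : Fin n → ChuObj.{v, u}}
    (F : ∀ k, Others A B k ⥤ Val A B k) (k : Fin m ⊕ Fin n) : Vars A B ⥤ Type v :=
  Functor.prod' (Pi.eval (fun l => Var A B l) k) (omitVar A B k ⋙ F k) ⋙ pairing A B k

/-- Horizontal polyarrows `(A₁, …, Aₘ) → (B₁, …, Bₙ)` of `Chu(Cat, Set)`, i.e. polarized
multivariable adjunctions: functors `fᵢ⁻ = comp (inl i)` and `fⱼ⁺ = comp (inr j)`, each depending
on all variables but its own, with a clique on the functors `A̲ᵢ ∘ (1, fᵢ⁻)`,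
`B̲ⱼ ∘ (1, fⱼ⁺)`. -/
structure PolyArrow (A : Fin m → ChuObj.{v, u}) (B : Fin n → ChuObj.{v, u}) where
  comp (k : Fin m ⊕ Fin n) : Others A B k ⥤ Val A B k
  clique : Clique (hetero comp)

variable {A C : Fin m → ChuObj.{v, u}} {B D : Fin n → ChuObj.{v, u}}

/-- The action of vertical arrows on a single variable: `uᵢ⁺` or `vⱼ⁻`. -/
def varMap (s : ∀ i, VertArrow (A i) (C i)) (t : ∀ j, VertArrow (B j) (D j)) :
    (k : Fin m ⊕ Fin n) → Var A B k ⥤ Var C D k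
  | .inl i => (s i).pos
  | .inr j => (t j).neg

/-- The action of vertical arrows on the codomain of a component: `uᵢ⁻` or `vⱼ⁺`. -/
def valMap (s : ∀ i, VertArrow (A i) (C i)) (t : ∀ j, VertArrow (B j) (D j)) :
    (k : Fin m ⊕ Fin n) → Val A B k ⥤ Val C D k
  | .inl i => (s i).neg
  | .inr j => (t j).pos

/-- The action of vertical arrows on the pairings: `u̲ᵢ` or `v̲ⱼ`. -/
def pairingMap (s : ∀ i, VertArrow (A i) (C i)) (t : ∀ j, VertArrow (B j) (D j)) :
    (k : Fin m ⊕ Fin n) →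
      (pairing A B k ⟶ (varMap s t k).prod (valMap s t k) ⋙ pairing C D k)
  | .inl i => (s i).pair
  | .inr j =>
    { app := fun p => (t j).pair.app (p.2, p.1)
      naturality := fun _ _ h => (t j).pair.naturality (Prod.mkHom h.2 h.1) }

/-- The action of vertical arrows on the product of all variables. -/
def varsMap (s : ∀ i, VertArrow (A i) (C i)) (t : ∀ j, VertArrow (B j) (D j)) :
    Vars A B ⥤ Vars C D :=
  Functor.pi (varMap s t)

/-- The action of vertical arrows on the product of all variables but the `k`-th one. -/
def othersMap (s : ∀ i, VertArrow (A i) (C i)) (t : ∀ j, VertArrow (B j) (D j))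
    (k : Fin m ⊕ Fin n) : Others A B k ⥤ Others C D k :=
  Functor.pi fun l : {l : Fin m ⊕ Fin n // l ≠ k} => varMap s t l.1

/-- The type of the natural transformations that may be the `k`-th component of a 2-cell:
`μᵢ⁻ : uᵢ⁻ ∘ fᵢ⁻ ⟶ gᵢ⁻ ∘ (u⁺, v⁻)` if `k = inl i`, and
`μⱼ⁺ : vⱼ⁺ ∘ fⱼ⁺ ⟶ gⱼ⁺ ∘ (u⁺, v⁻)` if `k = inr j`. -/
abbrev CompTrans (s : ∀ i, VertArrow (A i) (C i)) (t : ∀ j, VertArrow (B j) (D j))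
    (f : PolyArrow A B) (g : PolyArrow C D) (k : Fin m ⊕ Fin n) :=
  f.comp k ⋙ valMap s t k ⟶ othersMap s t k ⋙ g.comp k

/-- The pasting `u̲ᵢ ∘ (1, μᵢ⁻)` or `v̲ⱼ ∘ (1, μⱼ⁺)`: the function
`A̲ᵢ(xᵢ, fᵢ⁻(x)) → C̲ᵢ(uᵢ⁺ xᵢ, uᵢ⁻ fᵢ⁻(x)) → C̲ᵢ(uᵢ⁺ xᵢ, gᵢ⁻(u⁺ x, v⁻ x))`, and similarly for
`fⱼ⁺`. -/
def act (s : ∀ i, VertArrow (A i) (C i)) (t : ∀ j, VertArrow (B j) (D j))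
    (f : PolyArrow A B) (g : PolyArrow C D) (k : Fin m ⊕ Fin n) (μ : CompTrans s t f g k) :
    hetero f.comp k ⟶ varsMap s t ⋙ hetero g.comp k where
  app x :=
    (pairingMap s t k).app (x k, (f.comp k).obj ((omitVar A B k).obj x)) ≫
      (pairing C D k).map (Prod.mkHom (𝟙 ((varMap s t k).obj (x k)))
        (μ.app ((omitVar A B k).obj x)))
  naturality x y h := by
    have h₁ := (pairingMap s t k).naturality
      (Prod.mkHom (h k) ((f.comp k).map ((omitVar A B k).map h)) :
        ((x k, (f.comp k).obj ((omitVar A B k).obj x)) : Var A B k × Val A B k) ⟶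
          (y k, (f.comp k).obj ((omitVar A B k).obj y)))
    have h₂ : (valMap s t k).map ((f.comp k).map ((omitVar A B k).map h)) ≫
        μ.app ((omitVar A B k).obj y) = μ.app ((omitVar A B k).obj x) ≫
          (g.comp k).map ((othersMap s t k).map ((omitVar A B k).map h)) :=
      μ.naturality ((omitVar A B k).map h)
    refine (Category.assoc _ _ _).symm.trans ((congrArg (· ≫ _) h₁).trans ?_)
    refine (Category.assoc _ _ _).trans (Eq.trans ?_ (Category.assoc _ _ _).symm)
    refine congrArg (_ ≫ ·) ?_
    refine ((pairing C D k).map_comp _ _).symm.trans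
      (Eq.trans (congrArg (pairing C D k).map ?_) ((pairing C D k).map_comp _ _))
    refine Prod.ext ?_ h₂
    exact (Category.comp_id _).trans (Category.id_comp _).symm

/-- 2-cells of `Chu(Cat, Set)` with left and right boundary `s`, `t`, top `f` and bottom `g`:
families of transformations `μᵢ⁻`, `μⱼ⁺` any two of which are compatible with the adjunction
isomorphisms of `f` and `g`. -/
@[ext]
structure Cell (s : ∀ i, VertArrow (A i) (C i)) (t : ∀ j, VertArrow (B j) (D j))
    (f : PolyArrow A B) (g : PolyArrow C D) where
  comp (k : Fin m ⊕ Fin n) : CompTrans s t f g k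
  compat (k l : Fin m ⊕ Fin n) :
    (f.clique.iso k l).hom ≫ act s t f g l (comp l) =
      act s t f g k (comp k) ≫ Functor.whiskerLeft (varsMap s t) (g.clique.iso k l).hom

end Poly

/-! ### The poly double category `MAdj` of multivariable adjunctions -/

/-- The representable object `(𝒜, 𝒜ᵒᵖ, hom)`, with `hom (a, a') = 𝒜(a', a)`. -/
abbrev repr (𝒜 : Cat.{v, u}) : ChuObj.{v, u} where
  pos := 𝒜
  neg := Cat.of 𝒜ᵒᵖ
  pair := CategoryTheory.Prod.swap 𝒜 𝒜ᵒᵖ ⋙ Functor.hom 𝒜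

/-- The vertical arrow `(F, Fᵒᵖ, hom_F)` of a functor `F`. -/
abbrev reprMap {𝒜 ℬ : Cat.{v, u}} (F : 𝒜 ⥤ ℬ) : VertArrow (repr 𝒜) (repr ℬ) where
  pos := F
  neg := F.op
  pair :=
    { app := fun p => TypeCat.ofHom fun h : p.2.unop ⟶ p.1 => F.map h
      naturality := fun p q h => by
        ext x
        exact (F.map_comp _ _).trans (congrArg (_ ≫ ·) (F.map_comp _ _)) }

section MAdj

variable {m n : ℕ}

/-- Horizontal polyarrows `(𝒜₁, …, 𝒜ₘ) → (ℬ₁, …, ℬₙ)` of `MAdj`: multivariable adjunctions, i.e.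
polyarrows of `Chu(Cat, Set)` between representable objects. -/
abbrev MHom (A : Fin m → Cat.{v, u}) (B : Fin n → Cat.{v, u}) :=
  PolyArrow (fun i => repr (A i)) (fun j => repr (B j))

variable {A C : Fin m → Cat.{v, u}} {B D : Fin n → Cat.{v, u}}

/-- The possible `k`-th components of a 2-cell of `MAdj`. -/
abbrev MCompTrans (s : ∀ i, A i ⥤ C i) (t : ∀ j, B j ⥤ D j) (f : MHom A B) (g : MHom C D)
    (k : Fin m ⊕ Fin n) :=
  CompTrans (fun i => reprMap (s i)) (fun j => reprMap (t j)) f g k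

/-- 2-cells of `MAdj`: all 2-cells of `Chu(Cat, Set)` whose boundary lies in `MAdj`. -/
abbrev MCell (s : ∀ i, A i ⥤ C i) (t : ∀ j, B j ⥤ D j) (f : MHom A B) (g : MHom C D) :=
  Cell (fun i => reprMap (s i)) (fun j => reprMap (t j)) f g

/-- Transpose an element `e` along the adjunction isomorphism of `f` from the `l`-th hom-functor to
the `k`-th one, apply the transformation `τ` there, and transpose back along the adjunction
isomorphism of `g`. -/
def conj (s : ∀ i, A i ⥤ C i) (t : ∀ j, B j ⥤ D j) (f : MHom A B) (g : MHom C D)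
    (k l : Fin m ⊕ Fin n) (τ : MCompTrans s t f g k)
    (x : Vars (fun i => repr (A i)) (fun j => repr (B j))) (e : (hetero f.comp l).obj x) :
    (hetero g.comp l).obj
      ((varsMap (fun i => reprMap (s i)) (fun j => reprMap (t j))).obj x) :=
  (g.clique.iso k l).hom.app _
    ((act (fun i => reprMap (s i)) (fun j => reprMap (t j)) f g k τ).app x
      ((f.clique.iso l k).hom.app x e))

/-- `σ` is the mate of `τ`. The mate is obtained from the unit of the adjunction of `f` between the
variables `k` and `l`, which is the transpose of an identity of `fₗ(x)`, by applying `τ` and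
transposing back along the adjunction of `g`. As the `l`-th component of `x` is redundant, it is
allowed to be any object with an isomorphism `e` to `fₗ(x)` in place of `fₗ(x)` itself, and the
result is composed with the image of `e⁻¹`. -/
def IsMate (s : ∀ i, A i ⥤ C i) (t : ∀ j, B j ⥤ D j) (f : MHom A B) (g : MHom C D)
    (k : Fin m ⊕ Fin n) (τ : MCompTrans s t f g k) :
    (l : Fin m ⊕ Fin n) → MCompTrans s t f g l → Prop
  | .inl i, σ =>
    ∀ (x : Vars (fun i => repr (A i)) (fun j => repr (B j)))
      (e : unop ((f.comp (.inl i)).obj ((omitVar _ _ (.inl i)).obj x)) ≅ x (.inl i)),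
      (σ.app ((omitVar _ _ (.inl i)).obj x)).unop =
        conj s t f g k (.inl i) τ x e.hom ≫ (s i).map e.inv
  | .inr j, σ =>
    ∀ (x : Vars (fun i => repr (A i)) (fun j => repr (B j)))
      (e : unop (x (.inr j)) ≅ (f.comp (.inr j)).obj ((omitVar _ _ (.inr j)).obj x)),
      σ.app ((omitVar _ _ (.inr j)).obj x) =
        (t j).map e.inv ≫ conj s t f g k (.inr j) τ x e.hom

end MAdj

end MultiAdj

/-! The idea is Yoneda plus transport along cliques. For a component `τ` at position `k`, `act`
records the transformation of heteromorphism functors that it induces. In `MAdj` the pairings are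
hom-functors and a functor preserves identities, so a component is recovered from the image of the
identity of the value of `f` at `k`; hence `act` is a bijection at every position
(`pasting_bijective`, `act_reprMap_bijective`).

A 2-cell is therefore the same as a family of transformations of heteromorphism functors that
commute with the cliques of `f` and `g`. Since clique members are isomorphisms, one member of such a
family determines all others, and by the cocycle identities any single transformation extends to a
family (`Cell.comp_bijective`). Evaluating the transported transformation at an identity gives the
mate formula.

In `Chu(Cat, Set)` the pairing may be terminal. Then `act` forgets everything and compatibility is
vacuous, so the two components vary independently. -/

namespace MultiAdj

/-! ### Yoneda lemma for pairings with universal elements -/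

section Yoneda

universe v₁ v₂ v₃ v₄ v₅ v₆ u₁ u₂ u₃ u₄ u₅ u₆ w

variable {X : Type u₁} [Category.{v₁} X] {Y : Type u₂} [Category.{v₂} Y]
  {X' : Type u₃} [Category.{v₃} X'] {Y' : Type u₄} [Category.{v₄} Y']
  {W : Type u₅} [Category.{v₅} W] {W' : Type u₆} [Category.{v₆} W']
  {P : X × Y ⥤ Type w} {P' : X' × Y' ⥤ Type w} {S : X ⥤ X'} {T : Y ⥤ Y'}

/-- The pasting of a transformation `μ` with a morphism of pairings `p`. -/
def pasting (p : P ⟶ S.prod T ⋙ P') {F : W ⥤ Y} {G : W' ⥤ Y'} {Q : W ⥤ W'}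
    (μ : F ⋙ T ⟶ Q ⋙ G) : (𝟭 X).prod F ⋙ P ⟶ S.prod (Q ⋙ G) ⋙ P' where
  app z := p.app (z.1, F.obj z.2) ≫ P'.map (Prod.mkHom (𝟙 (S.obj z.1)) (μ.app z.2))
  naturality z z' h := by
    have h₁ := p.naturality (Prod.mkHom h.1 (F.map h.2) : (z.1, F.obj z.2) ⟶ (z'.1, F.obj z'.2))
    have h₂ := μ.naturality h.2
    refine (Category.assoc _ _ _).symm.trans ((congrArg (· ≫ _) h₁).trans ?_)
    refine (Category.assoc _ _ _).trans (Eq.trans ?_ (Category.assoc _ _ _).symm)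
    refine congrArg (_ ≫ ·) ?_
    refine (P'.map_comp _ _).symm.trans (Eq.trans (congrArg P'.map ?_) (P'.map_comp _ _))
    exact Prod.ext ((Category.comp_id _).trans (Category.id_comp _).symm) h₂

/-- Every object `y` has an element of the pairing with `y` that generates `P (-, y)` and whose
image under `p` is universal for `P' (S x, -)`. -/
def HasUniversalElements (p : P ⟶ S.prod T ⋙ P') : Prop :=
  ∀ y, ∃ (x : X) (e : P.obj (x, y)),
    (∀ (x' : X) (h : P.obj (x', y)), ∃ a : x ⟶ x', P.map (Prod.mkHom a (𝟙 y)) e = h) ∧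
    ∀ (y' : Y') (e' : P'.obj (S.obj x, y')), ∃! b : T.obj y ⟶ y',
      P'.map (Prod.mkHom (𝟙 (S.obj x)) b) (p.app (x, y) e) = e'

/-- Yoneda with parameters: universality of `p e` makes `μ` determined by, and definable from, the
values of the pasting at the chosen elements `e`; generation by `e` extends the agreement to all
elements. -/
theorem pasting_bijective {p : P ⟶ S.prod T ⋙ P'} (hp : HasUniversalElements p)
    {F : W ⥤ Y} {G : W' ⥤ Y'} {Q : W ⥤ W'} :
    Function.Bijective (pasting p : (F ⋙ T ⟶ Q ⋙ G) → _) := by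
  choose r e he hu using hp
  refine ⟨fun μ ν h => ?_, fun α => ?_⟩
  · ext w
    refine (hu (F.obj w) _ _).unique rfl ?_
    exact (ConcreteCategory.congr_hom (NatTrans.congr_app h (r (F.obj w), w)) (e (F.obj w))).symm
  · choose b hb using fun w => (hu (F.obj w) _ (α.app (r (F.obj w), w) (e (F.obj w)))).exists
    -- `hb` gives this only at the generator; naturality in the first variable carries it along `a`
    -- to every `h`.
    have key (x : X) (w : W) (h : P.obj (x, F.obj w)) :
        P'.map (Prod.mkHom (𝟙 (S.obj x)) (b w)) (p.app (x, F.obj w) h) = α.app (x, w) h := by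
      obtain ⟨a, rfl⟩ := he _ x h
      have h₁ := ConcreteCategory.congr_hom (p.naturality (Prod.mkHom a (𝟙 (F.obj w)))) (e _)
      have h₂ := ConcreteCategory.congr_hom (α.naturality
        (Prod.mkHom a (𝟙 w) : (r (F.obj w), w) ⟶ (x, w))) (e _)
      have h₃ : P'.map (Prod.mkHom (S.map a) (T.map (𝟙 (F.obj w)))) ≫
          P'.map (Prod.mkHom (𝟙 (S.obj x)) (b w)) =
          P'.map (Prod.mkHom (𝟙 (S.obj _)) (b w)) ≫
            P'.map (Prod.mkHom (S.map a) (G.map (Q.map (𝟙 w)))) := by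
        rw [← P'.map_comp, ← P'.map_comp]
        congr 1
        ext <;> simp
      refine (congrArg _ h₁).trans ((ConcreteCategory.congr_hom h₃ _).trans ?_)
      refine (congrArg _ (hb w)).trans (h₂.symm.trans ?_)
      refine congrArg _ (ConcreteCategory.congr_hom (congrArg P.map ?_) _)
      exact Prod.ext rfl (F.map_id w)
    refine ⟨⟨b, fun w w' φ => ?_⟩, ?_⟩
    -- Naturality of `b` is tested on the universal element over `F w`. Its image over `F w'` need
    -- not be the generator chosen there, so `key` is needed at an arbitrary element.
    · refine (hu (F.obj w) _ _).unique rfl ?_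
      have h₁ := ConcreteCategory.congr_hom
        (p.naturality (Prod.mkHom (𝟙 (r (F.obj w))) (F.map φ))) (e _)
      have h₂ := ConcreteCategory.congr_hom (α.naturality
        (Prod.mkHom (𝟙 (r (F.obj w))) φ : (r (F.obj w), w) ⟶ (r (F.obj w), w'))) (e _)
      have h₃ : P'.map (Prod.mkHom (𝟙 (S.obj (r (F.obj w)))) (b w ≫ G.map (Q.map φ))) =
          P'.map (Prod.mkHom (𝟙 _) (b w)) ≫
            P'.map (Prod.mkHom (S.map (𝟙 (r (F.obj w)))) (G.map (Q.map φ))) := by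
        rw [← P'.map_comp]
        congr 1
        ext <;> simp
      have h₄ : P'.map (Prod.mkHom (𝟙 (S.obj (r (F.obj w)))) (T.map (F.map φ) ≫ b w')) =
          P'.map (Prod.mkHom (S.map (𝟙 (r (F.obj w)))) (T.map (F.map φ))) ≫
            P'.map (Prod.mkHom (𝟙 _) (b w')) := by
        rw [← P'.map_comp]
        congr 1
        ext <;> simp
      refine (ConcreteCategory.congr_hom h₃ _).trans ((congrArg _ (hb w)).trans ?_)
      refine h₂.symm.trans (Eq.trans ?_ (ConcreteCategory.congr_hom h₄ _).symm)
      exact (key (r (F.obj w)) w' (P.map (Prod.mkHom (𝟙 (r (F.obj w))) (F.map φ)) (e (F.obj w)))).symm.trans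
        (congrArg (P'.map (Prod.mkHom (𝟙 (S.obj (r (F.obj w)))) (b w'))) h₁)
    · ext z h
      exact key z.1 z.2 h

theorem whiskerLeft_bijective {V : Type*} [Category* V] (R : V ⥤ X) [R.IsEquivalence]
    (H K : X ⥤ Y) :
    Function.Bijective (fun α : H ⟶ K => Functor.whiskerLeft R α) :=
  -- `congrLeft` precomposes with the inverse, so the symmetric equivalence is the one that whiskers
  -- with `R`.
  R.asEquivalence.symm.congrLeft.fullyFaithfulFunctor.homEquiv.bijective

end Yoneda

/-! ### Separating one variable from the others -/

section Extension

variable {m n : ℕ} (A : Fin m → ChuObj.{v, u}) (B : Fin n → ChuObj.{v, u})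

theorem exists_omitVar_eq (k : Fin m ⊕ Fin n) (a : Var A B k) (z : Others A B k) :
    ∃ x : Vars A B, x k = a ∧ (omitVar A B k).obj x = z := by
  classical
  refine ⟨fun l => if h : l = k then h ▸ a else z ⟨l, h⟩, dif_pos rfl, ?_⟩
  funext l
  exact dif_neg l.2

/-- The splitting of the product of all variables into the `k`-th one and the others. -/
abbrev splitVar (k : Fin m ⊕ Fin n) : Vars A B ⥤ Var A B k × Others A B k :=
  Functor.prod' (Pi.eval (fun l => Var A B l) k) (omitVar A B k)

/-- This bridges `act`, defined over the product of all variables, and the Yoneda argument, which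
needs the `k`-th variable as a separate factor. -/
instance splitVar_isEquivalence (k : Fin m ⊕ Fin n) : (splitVar A B k).IsEquivalence where
  faithful := ⟨fun {x y a b} h => by
    funext l
    by_cases hl : l = k
    · subst hl
      exact congrArg Prod.fst h
    · exact congrFun (congrArg Prod.snd h) ⟨l, hl⟩⟩
  full := ⟨fun {x y} h => by
    classical
    refine ⟨fun l => if hl : l = k then by subst hl; exact h.1 else h.2 ⟨l, hl⟩, ?_⟩
    refine Prod.ext (dif_pos rfl) (funext fun l => ?_)
    exact dif_neg l.2⟩
  essSurj := ⟨fun ⟨a, z⟩ => by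
    obtain ⟨x, h₁, h₂⟩ := exists_omitVar_eq A B k a z
    exact ⟨x, ⟨eqToIso (Prod.ext h₁ h₂)⟩⟩⟩

end Extension

/-- By definition `act` is `pasting` restricted along the equivalence `splitVar`, hence a composite
of two bijections. -/
theorem act_bijective {m n : ℕ} {A C : Fin m → ChuObj.{v, u}} {B D : Fin n → ChuObj.{v, u}}
    (s : ∀ i, VertArrow (A i) (C i)) (t : ∀ j, VertArrow (B j) (D j))
    (f : PolyArrow A B) (g : PolyArrow C D) (k : Fin m ⊕ Fin n)
    (hk : HasUniversalElements (pairingMap s t k)) :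
    Function.Bijective (act s t f g k) :=
  (whiskerLeft_bijective (splitVar A B k) _ _).comp
    (pasting_bijective hk (F := f.comp k) (G := g.comp k) (Q := othersMap s t k))

/-! ### Representable pairings -/

section MAdj

variable {m n : ℕ} {A C : Fin m → Cat.{v, u}} {B D : Fin n → Cat.{v, u}}

/-- The universal element is the identity of `y`: it generates the hom-functor by Yoneda, and
functors send it to an identity, which is again universal. -/
theorem hasUniversalElements_reprMap (s : ∀ i, A i ⥤ C i) (t : ∀ j, B j ⥤ D j)
    (k : Fin m ⊕ Fin n) :
    HasUniversalElements
      (pairingMap (fun i => reprMap (s i)) (fun j => reprMap (t j)) k) := by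
  rcases k with i | j
  · intro y
    refine ⟨unop y, 𝟙 (unop y), fun x h => ⟨h, ?_⟩, fun y' e => ⟨Quiver.Hom.op e, ?_, ?_⟩⟩
    · exact (Category.id_comp _).trans (Category.id_comp _)
    · exact (congrArg (e ≫ ·) ((Category.comp_id _).trans ((s i).map_id _))).trans
        (Category.comp_id _)
    · intro b hb
      refine congrArg Quiver.Hom.op (Eq.trans ?_ hb)
      exact ((congrArg (b.unop ≫ ·) ((Category.comp_id _).trans ((s i).map_id _))).trans
        (Category.comp_id _)).symm
  · intro y
    refine ⟨op y, 𝟙 y, fun x h => ⟨Quiver.Hom.op h, ?_⟩, fun y' e => ⟨e, ?_, ?_⟩⟩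
    · exact (congrArg (h ≫ ·) (Category.id_comp _)).trans (Category.comp_id _)
    · exact (Category.id_comp _).trans ((congrArg (· ≫ e) ((t j).map_id _)).trans
        (Category.id_comp _))
    · intro b hb
      refine Eq.trans ?_ hb
      exact ((Category.id_comp _).trans ((congrArg (· ≫ b) ((t j).map_id _)).trans
        (Category.id_comp _))).symm

variable {s : ∀ i, A i ⥤ C i} {t : ∀ j, B j ⥤ D j} {f : MHom A B} {g : MHom C D}

theorem act_reprMap_bijective (k : Fin m ⊕ Fin n) :
    Function.Bijective (act (fun i => reprMap (s i)) (fun j => reprMap (t j)) f g k) :=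
  act_bijective _ _ f g k (hasUniversalElements_reprMap s t k)

end MAdj

/-! ### Cliques and the extension of one component to a 2-cell -/

section Clique

variable {X : Type*} [Category* X] {K : Type*} {φ : K → X} (c : Clique φ)

theorem Clique.hom_comp (k l p : K) : (c.iso k l).hom ≫ (c.iso l p).hom = (c.iso k p).hom :=
  congrArg Iso.hom (c.iso_trans k l p)

theorem Clique.hom_self (k : K) : (c.iso k k).hom = 𝟙 (φ k) :=
  congrArg Iso.hom (c.iso_self k)

end Clique

section Cells

variable {m n : ℕ} {A C : Fin m → ChuObj.{v, u}} {B D : Fin n → ChuObj.{v, u}}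
  {s : ∀ i, VertArrow (A i) (C i)} {t : ∀ j, VertArrow (B j) (D j)}
  {f : PolyArrow A B} {g : PolyArrow C D}

theorem Cell.act_eq (μ : Cell s t f g) (k l : Fin m ⊕ Fin n) :
    act s t f g l (μ.comp l) = (f.clique.iso l k).hom ≫ act s t f g k (μ.comp k) ≫
      Functor.whiskerLeft (varsMap s t) (g.clique.iso k l).hom := by
  rw [← μ.compat k l, ← Category.assoc, f.clique.hom_comp, f.clique.hom_self, Category.id_comp]

/-- Conjugation by the cliques moves `act` of the `k`-th component to every position `l`, where
bijectivity of `act` turns it back into a unique component. This holds for any boundary in `Chu(Cat,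
Set)` with bijective `act`. -/
theorem Cell.comp_bijective (h : ∀ l, Function.Bijective (act s t f g l)) (k : Fin m ⊕ Fin n) :
    Function.Bijective (fun μ : Cell s t f g => μ.comp k) := by
  refine ⟨fun μ ν e => ?_, fun τ => ?_⟩
  · ext1
    funext l
    apply (h l).1
    have e' : μ.comp k = ν.comp k := e
    rw [μ.act_eq k l, ν.act_eq k l, e']
  · choose σ hσ using fun l => (h l).2 ((f.clique.iso l k).hom ≫ act s t f g k τ ≫
      Functor.whiskerLeft (varsMap s t) (g.clique.iso k l).hom)
    refine ⟨⟨σ, fun p q => ?_⟩, ?_⟩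
    · rw [hσ, hσ, ← Category.assoc, f.clique.hom_comp, Category.assoc, Category.assoc,
        ← Functor.whiskerLeft_comp, g.clique.hom_comp]
    -- The extension returns the prescribed `τ` at `k` because the isomorphisms from `k` to itself
    -- are identities.
    · apply (h k).1
      change act s t f g k (σ k) = _
      rw [hσ, f.clique.hom_self, g.clique.hom_self, Functor.whiskerLeft_id', Category.comp_id,
        Category.id_comp]

end Cells

/-! ### Mates -/

section Mates

variable {m n : ℕ} {A C : Fin m → Cat.{v, u}} {B D : Fin n → Cat.{v, u}}
  {s : ∀ i, A i ⥤ C i} {t : ∀ j, B j ⥤ D j} {f : MHom A B} {g : MHom C D}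

theorem conj_comp (μ : MCell s t f g) (k l : Fin m ⊕ Fin n)
    (x : Vars (fun i => repr (A i)) (fun j => repr (B j))) (e : (hetero f.comp l).obj x) :
    conj s t f g k l (μ.comp k) x e =
      (act (fun i => reprMap (s i)) (fun j => reprMap (t j)) f g l (μ.comp l)).app x e := by
  rw [μ.act_eq k l]
  rfl

/-- By `conj_comp` the round trip through `k` is `act` at `l`. On `e.hom` this is `μ.comp l`
composed with the image of `e.hom`, which the image of `e.inv` cancels. -/
theorem isMate_comp (μ : MCell s t f g) (k l : Fin m ⊕ Fin n) :
    IsMate s t f g k (μ.comp k) l (μ.comp l) := by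
  rcases l with i | j
  · intro x e
    refine Eq.trans ?_ (congrArg (· ≫ (s i).map e.inv) (conj_comp μ k (.inl i) x e.hom).symm)
    refine Eq.symm ((Category.assoc _ _ _).trans ((congrArg (_ ≫ ·) ?_).trans
      (Category.comp_id _)))
    refine (congrArg (· ≫ _) (Category.comp_id _)).trans ?_
    exact ((s i).map_comp _ _).symm.trans ((congrArg (s i).map e.hom_inv_id).trans
      ((s i).map_id _))
  · intro x e
    refine Eq.trans ?_ (congrArg ((t j).map e.inv ≫ ·) (conj_comp μ k (.inr j) x e.hom).symm)
    refine Eq.symm (Eq.trans (congrArg (_ ≫ ·) (Category.id_comp _)) ?_)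
    refine (Category.assoc _ _ _).symm.trans (Eq.trans (congrArg (· ≫ _) ?_)
      (Category.id_comp _))
    exact ((t j).map_comp _ _).symm.trans ((congrArg (t j).map e.inv_hom_id).trans
      ((t j).map_id _))

/-- The mate condition prescribes every value of `σ`: the `l`-th variable is free, so it can be set
to the value of `f` at `l`, with `e` coming from an equality. -/
theorem IsMate.unique {k : Fin m ⊕ Fin n} {τ : MCompTrans s t f g k} {l : Fin m ⊕ Fin n}
    {σ σ' : MCompTrans s t f g l} (h : IsMate s t f g k τ l σ) (h' : IsMate s t f g k τ l σ') :
    σ = σ' := by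
  rcases l with i | j
  · ext z
    obtain ⟨x, hx, rfl⟩ := exists_omitVar_eq (fun i => repr (A i)) (fun j => repr (B j))
      (.inl i) (unop ((f.comp (.inl i)).obj z)) z
    exact Quiver.Hom.unop_inj ((h x (eqToIso hx.symm)).trans (h' x (eqToIso hx.symm)).symm)
  · ext z
    obtain ⟨x, hx, rfl⟩ := exists_omitVar_eq (fun i => repr (A i)) (fun j => repr (B j))
      (.inr j) (op ((f.comp (.inr j)).obj z)) z
    exact (h x (eqToIso (congrArg unop hx))).trans (h' x (eqToIso (congrArg unop hx))).symm

end Mates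

/-! ### A boundary in `Chu(Cat, Set)` whose components are independent -/

section Counterexample

/-- The object of the group of order two, as a category with one object. -/
inductive TwoObj : Type u
  | star

instance : Category.{v} TwoObj.{u} where
  Hom _ _ := ULift.{v} (Multiplicative (ZMod 2))
  id _ := 1
  comp a b := a * b
  id_comp := one_mul
  comp_id := mul_one
  assoc := mul_assoc

/-- The endomorphism of the object of `TwoObj` given by an element of the group of order two. -/
def TwoObj.endo (a : Multiplicative (ZMod 2)) :
    (star : Cat.of.{v, u} TwoObj) ⟶ (star : Cat.of.{v, u} TwoObj) :=
  (⟨a⟩ : ULift.{v} (Multiplicative (ZMod 2)))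

theorem TwoObj.endo_injective : Function.Injective endo.{v, u} :=
  fun _ _ h => congrArg ULift.down h

/-- The object of `Chu(Cat, Set)` on two copies of `TwoObj` with the terminal pairing. -/
abbrev twoChu : ChuObj.{v, u} where
  pos := Cat.of TwoObj
  neg := Cat.of TwoObj
  pair := (Functor.const _).obj PUnit

/-- The identity vertical arrow of `twoChu`. -/
abbrev twoVert : VertArrow twoChu.{v, u} twoChu where
  pos := 𝟭 _
  neg := 𝟭 _
  pair := 𝟙 _

/-- The constant family of length one with value `twoChu`. -/
abbrev twoFam : Fin 1 → ChuObj.{v, u} := fun _ => twoChu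

/-- With all heteromorphism functors equal to one constant functor, `eqToIso` supplies the clique of
`twoPoly`. -/
theorem hetero_two (F : ∀ k, Others twoFam.{v, u} twoFam k ⥤ Val twoFam.{v, u} twoFam k)
    (k : Fin 1 ⊕ Fin 1) : hetero F k = (Functor.const _).obj PUnit := by
  rcases k with _ | _ <;> rfl

/-- The polyarrow with constant components. -/
def twoPoly : PolyArrow twoFam.{v, u} twoFam where
  comp
    | .inl _ => (Functor.const _).obj TwoObj.star
    | .inr _ => (Functor.const _).obj TwoObj.star
  clique :=
    { iso := fun k l => eqToIso ((hetero_two _ k).trans (hetero_two _ l).symm)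
      iso_self := fun _ => rfl
      iso_trans := fun _ _ _ => eqToIso_trans _ _ }

/-- The 2-cell whose components are given by two endomorphisms. -/
def twoCell (a : Fin 1 ⊕ Fin 1 → Multiplicative (ZMod 2)) :
    Cell (fun _ => twoVert.{v, u}) (fun _ => twoVert) twoPoly twoPoly where
  comp
    | .inl i =>
      { app := fun _ => TwoObj.endo.{v, u} (a (.inl i))
        naturality := fun _ _ _ => (Category.id_comp _).trans (Category.comp_id _).symm }
    | .inr j =>
      { app := fun _ => TwoObj.endo.{v, u} (a (.inr j))
        naturality := fun _ _ _ => (Category.id_comp _).trans (Category.comp_id _).symm }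
  compat k l := by
    -- Both sides of the compatibility square take values in a singleton, so it commutes for any
    -- choice of components.
    have : ∀ x, Subsingleton ((varsMap (fun _ => twoVert) (fun _ => twoVert) ⋙
        hetero twoPoly.{v, u}.comp l).obj x) := by
      intro x
      rw [hetero_two]
      exact inferInstanceAs (Subsingleton PUnit)
    ext x h
    exact Subsingleton.elim _ _

theorem twoCell_comp_eq_iff {a b : Fin 1 ⊕ Fin 1 → Multiplicative (ZMod 2)}
    {k : Fin 1 ⊕ Fin 1} : (twoCell.{v, u} a).comp k = (twoCell b).comp k ↔ a k = b k := by
  rcases k with i | j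
  · refine ⟨fun h => ?_, fun h => ?_⟩
    -- The transformations are compared at the object whose remaining variable is `star`.
    · exact TwoObj.endo_injective.{v, u} (NatTrans.congr_app h fun l => by
        rcases l with ⟨_ | _, _⟩ <;> exact TwoObj.star)
    · ext z
      exact congrArg TwoObj.endo.{v, u} h
  · refine ⟨fun h => ?_, fun h => ?_⟩
    · exact TwoObj.endo_injective.{v, u} (NatTrans.congr_app h fun l => by
        rcases l with ⟨_ | _, _⟩ <;> exact TwoObj.star)
    · ext z
      exact congrArg TwoObj.endo.{v, u} h

theorem not_injective_twoCell_comp (k : Fin 1 ⊕ Fin 1) :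
    ¬ Function.Injective (fun μ : Cell (fun _ => twoVert.{v, u}) (fun _ => twoVert)
      twoPoly twoPoly => μ.comp k) := by
  intro h
  -- Two cells that agree at `k` are made to differ at the other position: one has the trivial
  -- element of the group there, the other the generator.
  obtain ⟨l, hl⟩ : ∃ l, l ≠ k := ⟨k.swap, by cases k <;> simp⟩
  let a : Multiplicative (ZMod 2) := Multiplicative.ofAdd 1
  have e := @h (twoCell 1) (twoCell (Function.update 1 l a))
    (twoCell_comp_eq_iff.2 (Function.update_of_ne hl.symm _ _).symm)
  have e' := twoCell_comp_eq_iff.1 (congrArg (fun μ => μ.comp l) e)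
  rw [Function.update_self] at e'
  have e'' : (1 : Multiplicative (ZMod 2)) = Multiplicative.ofAdd 1 := e'
  exact absurd e'' (by decide)

end Counterexample

end MultiAdj

theorem mainTheorem9 :
    -- in `MAdj`, any single component can be prescribed and determines the 2-cell,
    -- and the other components are its mates
    (∀ (m n : ℕ) (A C : Fin m → Cat.{v, u}) (B D : Fin n → Cat.{v, u})
      (s : ∀ i, A i ⥤ C i) (t : ∀ j, B j ⥤ D j)
      (f : MultiAdj.MHom A B) (g : MultiAdj.MHom C D) (k : Fin m ⊕ Fin n),
      Function.Bijective (fun μ : MultiAdj.MCell s t f g => μ.comp k) ∧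
      ∀ (μ : MultiAdj.MCell s t f g) (l : Fin m ⊕ Fin n) (σ : MultiAdj.MCompTrans s t f g l),
        MultiAdj.IsMate s t f g k (μ.comp k) l σ ↔ σ = μ.comp l) ∧
    -- in `Chu(Cat, Set)`, a component need not determine the 2-cell
    (∃ (A C B D : Fin 1 → MultiAdj.ChuObj.{v, u})
      (s : ∀ i, MultiAdj.VertArrow (A i) (C i)) (t : ∀ j, MultiAdj.VertArrow (B j) (D j))
      (f : MultiAdj.PolyArrow A B) (g : MultiAdj.PolyArrow C D),
      ∀ k : Fin 1 ⊕ Fin 1,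
        ¬ Function.Injective (fun μ : MultiAdj.Cell s t f g => μ.comp k)) :=
  ⟨fun _ _ _ _ _ _ _ _ _ _ k =>
    ⟨MultiAdj.Cell.comp_bijective MultiAdj.act_reprMap_bijective k,
      fun μ l _ => ⟨fun h => h.unique (MultiAdj.isMate_comp μ k l),
        fun h => h ▸ MultiAdj.isMate_comp μ k l⟩⟩,
    _, _, _, _, _, _, _, _, MultiAdj.not_injective_twoCell_comp⟩
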